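/- Conventions. A $d$-variate extreme-value copula is a function $C:[0,1]^d\to[0,1]$ that is the restriction to $[0,1]^d$ of the distribution function of a probability law on $\mathbb{R}^d$ with one-dimensional margins uniform on $[0,1]$, and that satisfies $C(u_1^t,\ldots,u_d^t)=C(u_1,\ldots,u_d)^t$ for all $u\in[0,1]^d$ and $t\ge 0$. It is exchangeable if it is invariant under permutations of its arguments. It is conditionally iid if on some probability space there is a random vector $(X_1,\ldots,X_d)$ with distribution function $C$ whose components are independent and identically distributed conditionally on some sub-$\sigma$-algebra. The stable tail dependence function of $C$ is $\ell(x)=-\log C(e^{-x_1},\ldots,e^{-x_d})$, $x\in[0,\infty)^d$. Let $\mathfrak{L}^X_d$ be the set of all stable tail dependence functions of $d$-variate extreme-value copulas that are symmetric, i.e. invariant under permutations of their arguments. For $d\ge n$ the $n$-margin of $\ell\in\mathfrak{L}^X_d$ is $(x_1,\ldots,x_n)\mapsto\ell(x_1,\ldots,x_n,0,\ldots,0)$, and $\mathfrak{L}^X_{n,d}\subseteq\mathfrak{L}^X_n$ is the set of those elements of $\mathfrak{L}^X_n$ that are the $n$-margin of some element of $\mathfrak{L}^X_d$. For $q=(q_1,\ldots,q_n)\in[0,1]^n$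 with $q_1+\cdots+q_n=1$ put $$\ell^{(n)}_{[q]}(x)=\frac{1}{(n-1)!}\sum_{\sigma}\max\{x_1q_{\sigma(1)},\ldots,x_nq_{\sigma(n)}\},\qquad x\in[0,\infty)^n,$$ where $\sigma$ runs over all permutations of $\{1,\ldots,n\}$. Statement. Let $n\ge 2$. (i) If $q_1+\cdots+q_n=1$ and $0<q_1<\cdots<q_n<1$, then $\ell^{(n)}_{[q]}\in\mathfrak{L}^X_n$, and for every $d\ge n+1$ it is not the $n$-margin of any $\ell\in\mathfrak{L}^X_d$. (ii) Hence $\mathfrak{L}^X_{n,n+k}\subsetneq\mathfrak{L}^X_n$ for every $k\ge 1$. (iii) There is an exchangeable $n$-variate extreme-value copula that is not conditionally iid (in particular for $n=2$). -/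

import Mathlib

open MeasureTheory ProbabilityTheory
open scoped NNReal

universe u

/-- `μ` is a probability law on `ℝ^d` with margins uniform on `[0,1]`, and `C` is the restriction
to `[0,1]^d` of its distribution function. -/
structure IsCopulaLaw {d : ℕ} (μ : Measure (Fin d → ℝ)) (C : (Fin d → unitInterval) → ℝ) :
    Prop where
  isProb : IsProbabilityMeasure μ
  uniform : ∀ i, μ.map (fun x => x i) = volume.restrict (Set.Icc (0 : ℝ) 1)
  df : ∀ u, C u = μ.real {x | ∀ i, x i ≤ (u i : ℝ)}

/-- `C : [0,1]^d → ℝ` is a `d`-variate copula. -/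
def IsCopula {d : ℕ} (C : (Fin d → unitInterval) → ℝ) : Prop :=
  ∃ μ : Measure (Fin d → ℝ), IsCopulaLaw μ C

/-- The power `u ^ t` of `u ∈ [0,1]` with exponent `t ≥ 0` (where `0 ^ 0 = 1`). -/
noncomputable def unitPow (u : unitInterval) (t : ℝ≥0) : unitInterval :=
  ⟨(u : ℝ) ^ (t : ℝ), Real.rpow_nonneg u.2.1 _, Real.rpow_le_one u.2.1 u.2.2 t.2⟩

/-- Extreme-value copulas: copulas with `C(u₁^t, …, u_d^t) = C(u₁, …, u_d)^t`. -/
def IsExtremeValueCopula {d : ℕ} (C : (Fin d → unitInterval) → ℝ) : Prop :=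
  IsCopula C ∧
    ∀ (u : Fin d → unitInterval) (t : ℝ≥0), C (fun i => unitPow (u i) t) = C u ^ (t : ℝ)

/-- Invariance of a function of `d` variables under permutations of its arguments. For a copula
this is exchangeability. -/
def IsSymmetricFun {α : Type*} {d : ℕ} (f : (Fin d → α) → ℝ) : Prop :=
  ∀ (σ : Equiv.Perm (Fin d)) (x : Fin d → α), f (fun i => x (σ i)) = f x

/-- `e^{-x} ∈ [0,1]` for `x ≥ 0`. -/
noncomputable def expNeg (x : ℝ≥0) : unitInterval :=
  ⟨Real.exp (-(x : ℝ)), (Real.exp_pos _).le, Real.exp_le_one_iff.2 (neg_nonpos.2 x.2)⟩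

/-- The function `ℓ(x) = -log C(e^{-x₁}, …, e^{-x_d})` on `[0,∞)^d`. -/
noncomputable def stdfOf {d : ℕ} (C : (Fin d → unitInterval) → ℝ) : (Fin d → ℝ≥0) → ℝ :=
  fun x => -Real.log (C (fun i => expNeg (x i)))

/-- The set of symmetric stable tail dependence functions in dimension `d`. -/
def symSTDF (d : ℕ) : Set ((Fin d → ℝ≥0) → ℝ) :=
  {ℓ | (∃ C : (Fin d → unitInterval) → ℝ, IsExtremeValueCopula C ∧ ℓ = stdfOf C) ∧
    IsSymmetricFun ℓ}

/-- The `n`-margin `(x₁, …, x_n) ↦ ℓ(x₁, …, x_n, 0, …, 0)` of a function `ℓ` on `[0,∞)^d`,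
for `n ≤ d`. -/
def stdfMargin (n : ℕ) {d : ℕ} (ℓ : (Fin d → ℝ≥0) → ℝ) : (Fin n → ℝ≥0) → ℝ :=
  fun x => ℓ (fun j => if h : (j : ℕ) < n then x ⟨j, h⟩ else 0)

/-- The set of those symmetric stable tail dependence functions in dimension `n` that are the
`n`-margin of some symmetric stable tail dependence function in dimension `d`. -/
def symSTDFMargins (n d : ℕ) : Set ((Fin n → ℝ≥0) → ℝ) :=
  {ℓ | ℓ ∈ symSTDF n ∧ ∃ ℓ' ∈ symSTDF d, stdfMargin n ℓ' = ℓ}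

/-- `ℓ_q(x) = 1/(n-1)! ∑_σ max {x₁ q_{σ(1)}, …, x_n q_{σ(n)}}`, the sum being over all
permutations of the indices (for `n ≥ 1`). -/
noncomputable def extremalSTDF {n : ℕ} (q : Fin n → ℝ) : (Fin n → ℝ≥0) → ℝ :=
  fun x => 1 / ((n - 1).factorial : ℝ) *
    ∑ σ : Equiv.Perm (Fin n), ⨆ i : Fin n, (x i : ℝ) * q (σ i)

/-- The law `μ` on `ℝ^d` is conditionally iid: on some probability space there is a random vector
`(X₁, …, X_d)` with law `μ` whose components are independent and identically distributed
conditionally on some sub-σ-algebra `m`. -/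
def IsCondIIDLaw {d : ℕ} (μ : Measure (Fin d → ℝ)) : Prop :=
  ∃ (Ω : Type u) (m mΩ : MeasurableSpace Ω) (P : Measure Ω) (_ : IsProbabilityMeasure P)
    (X : Fin d → Ω → ℝ),
    (∀ i, Measurable (X i)) ∧ P.map (fun ω i => X i ω) = μ ∧ m ≤ mΩ ∧
    (∀ B : Fin d → Set ℝ, (∀ i, MeasurableSet (B i)) →
      P⟦⋂ i, X i ⁻¹' B i | m⟧ =ᵐ[P] fun ω => ∏ i, (P⟦X i ⁻¹' B i | m⟧) ω) ∧
    (∀ (i j : Fin d) (B : Set ℝ), MeasurableSet B →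
      P⟦X i ⁻¹' B | m⟧ =ᵐ[P] P⟦X j ⁻¹' B | m⟧)

/-- A copula is conditionally iid if it is the distribution function of a conditionally iid law. -/
def IsCondIIDCopula {d : ℕ} (C : (Fin d → unitInterval) → ℝ) : Prop :=
  ∃ μ : Measure (Fin d → ℝ), IsCopulaLaw μ C ∧ IsCondIIDLaw.{u} μ

/-!
For weights `q` write `ℓ_q = extremalSTDF q`.

*Membership.* If finitely many non-negative weights `p s i` satisfy `∑ s, p s i = 1` for all `i`,
then `X i = max_s U_s ^ (1 / p s i)`, with `U_s` independent and uniform on `[0,1]`, has distribution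
function `∏ s, min_i (u i) ^ p s i`, which is an extreme-value copula
(`isExtremeValueCopula_spectralCopula`). Taking permutations as index set and
`p σ i = q (σ i) / (n-1)!` gives a copula with tail dependence function `ℓ_q`.

*Non-extendibility.* Let `z` follow an extreme-value copula and let `Y i = -log (z i)`. Up to `o(t)`,
the probability that `Y` lies in a box scaled by `t` is `t` times an alternating sum of values of
`ℓ`. For `ℓ_q` this sum vanishes whenever the box misses all the rays spanned by the vectors
`(1 / q (σ i))_i` (`HasSTDF.tendsto_box`), on which the exponent measure lives. With
`R = q_max / q_min` and `θ > 1` at most the smallest ratio of two successive weights, each of these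
events for `n` coordinates of `Y` therefore has probability `o(t)`:
all coordinates are at least `t` and less than `tR`; one coordinate is less than `tθ` and another
one at least `tRθ`; two coordinates lie between `tR` and `tRθ`. If `ℓ_q` were a margin of a symmetric
`ℓ` in dimension `d > n`, all this would hold for any `n` among the first `n + 1` coordinates.
But whenever the minimum of `n + 1 ≥ 3` coordinates lies between `t` and `tθ`, one of these events
occurs for some `n` of them (`exists_degenerate_subvector`): deleting any one coordinate leaves a
coordinate that is at least `tR`, so two coordinates are at least `tR`, and neither is as large as
`tRθ`. The minimum, however, lies between `t` and `tθ` with a probability of exact order `t`.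

*Not conditionally iid.* If `X` is conditionally iid, then `P(X i ∈ B, X j ∈ B) ≥ P(X i ∈ B)²` by
Jensen's inequality (`IsCondIIDLaw.sq_le`). For `q = (1/3, 2/3, 0, …, 0)` the pair margin satisfies
`ℓ_q (1, 2) = 3/2 ℓ_q (1, 1)`, so that with `w = e^{-1/2}` and `s = w ^ (ℓ_q (1, 1) / 2) > w` the
interval `B = (w², w]` has `P(X 0 ∈ B, X 1 ∈ B) = (s - s²)² < (w - w²)² = P(X 0 ∈ B)²`.
-/

open scoped Topology

/-! ### Copulas with finitely many spectral weights -/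

/-- The function `u ↦ ∏ s, min_i (u i) ^ p s i`. It is a copula if the weights `p s i` are non-negative
and `∑ s, p s i = 1` for all `i`. -/
noncomputable def spectralCopula {ι : Type*} [Fintype ι] {d : ℕ} (p : ι → Fin d → ℝ)
    (u : Fin d → unitInterval) : ℝ :=
  ∏ s, ⨅ i, (u i : ℝ) ^ p s i

/-- The vector with components `max_s (ω s) ^ (1 / p s i)`, which has distribution function
`spectralCopula p` for uniform `ω`. A vanishing weight does not contribute to the maximum; the case
is split off because `ω s ^ (0⁻¹)` would be `1`. -/
noncomputable def spectralVector {ι : Type*} [Fintype ι] [Nonempty ι] {d : ℕ}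
    (p : ι → Fin d → ℝ) (ω : ι → ℝ) (i : Fin d) : ℝ :=
  Finset.univ.sup' Finset.univ_nonempty fun s => if p s i = 0 then 0 else ω s ^ (p s i)⁻¹

/-- The law of independent uniform variables on `[0,1]`, indexed by `ι`. -/
noncomputable def uniformCube (ι : Type*) [Fintype ι] : Measure (ι → ℝ) :=
  Measure.pi fun _ => volume.restrict (Set.Icc (0 : ℝ) 1)

instance isProbabilityMeasure_uniformIcc :
    IsProbabilityMeasure (volume.restrict (Set.Icc (0 : ℝ) 1)) :=
  ⟨by simp⟩

instance isProbabilityMeasure_uniformCube (ι : Type*) [Fintype ι] :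
    IsProbabilityMeasure (uniformCube ι) := by
  unfold uniformCube; infer_instance

lemma uniformCube_ae_mem (ι : Type*) [Fintype ι] :
    ∀ᵐ ω ∂uniformCube ι, ∀ s, ω s ∈ Set.Icc (0 : ℝ) 1 := by
  refine ae_all_iff.2 fun s => ?_
  exact (measurePreserving_eval (fun _ : ι => volume.restrict (Set.Icc (0 : ℝ) 1))
    s).quasiMeasurePreserving.ae (ae_restrict_mem measurableSet_Icc)

lemma uniformCube_real_Iic {ι : Type*} [Fintype ι] {w : ι → ℝ} (h0 : ∀ s, 0 ≤ w s)
    (h1 : ∀ s, w s ≤ 1) : (uniformCube ι).real {ω | ∀ s, ω s ≤ w s} = ∏ s, w s := by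
  have : {ω : ι → ℝ | ∀ s, ω s ≤ w s} = Set.univ.pi fun s => Set.Iic (w s) := by
    ext; simp [Pi.le_def]
  rw [this, measureReal_def, uniformCube, Measure.pi_pi, ENNReal.toReal_prod]
  refine Finset.prod_congr rfl fun s _ => ?_
  rw [Measure.restrict_apply measurableSet_Iic]
  have : Set.Iic (w s) ∩ Set.Icc 0 1 = Set.Icc 0 (w s) := by
    ext x; simp only [Set.mem_inter_iff, Set.mem_Iic, Set.mem_Icc]
    exact ⟨fun h => ⟨h.2.1, h.1⟩, fun h => ⟨h.2, h.1, h.2.trans (h1 s)⟩⟩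
  simp [this, h0 s]

/-- For `p = 0` both sides hold, the right one because `u ^ 0 = 1`, even for `u = 0`. -/
lemma ite_rpow_inv_le_iff {ω u p : ℝ} (hω : ω ∈ Set.Icc (0 : ℝ) 1) (hu : 0 ≤ u) (hp : 0 ≤ p) :
    (if p = 0 then 0 else ω ^ p⁻¹) ≤ u ↔ ω ≤ u ^ p := by
  split_ifs with h
  · simp [h, hu, hω.2]
  · exact Real.rpow_inv_le_iff_of_pos hω.1 hu (lt_of_le_of_ne hp (Ne.symm h))

lemma iInf_rpow_mem {d : ℕ} [NeZero d] {p : Fin d → ℝ} (hp : ∀ i, 0 ≤ p i)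
    (u : Fin d → unitInterval) : (⨅ i, (u i : ℝ) ^ p i) ∈ Set.Icc (0 : ℝ) 1 :=
  ⟨le_ciInf fun i => Real.rpow_nonneg (u i).2.1 _,
    (ciInf_le (Set.finite_range _).bddBelow 0).trans
      (Real.rpow_le_one (u 0).2.1 (u 0).2.2 (hp 0))⟩

lemma measurable_spectralVector {ι : Type*} [Fintype ι] [Nonempty ι] {d : ℕ}
    (p : ι → Fin d → ℝ) : Measurable (spectralVector p) := by
  refine measurable_pi_lambda _ fun i => ?_
  have h : ∀ s, Measurable fun ω : ι → ℝ => if p s i = 0 then 0 else ω s ^ (p s i)⁻¹ := fun s => by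
    split_ifs
    · exact measurable_const
    · exact (measurable_pi_apply s).pow_const _
  convert Finset.measurable_sup' Finset.univ_nonempty fun s _ => h s using 1
  ext ω
  simp [spectralVector, Finset.sup'_apply]

lemma spectralVector_le_iff {ι : Type*} [Fintype ι] [Nonempty ι] {d : ℕ} [NeZero d]
    {p : ι → Fin d → ℝ} (hp : ∀ s i, 0 ≤ p s i) {ω : ι → ℝ}
    (hω : ∀ s, ω s ∈ Set.Icc (0 : ℝ) 1) (u : Fin d → unitInterval) :
    (∀ i, spectralVector p ω i ≤ u i) ↔ ∀ s, ω s ≤ ⨅ i, (u i : ℝ) ^ p s i := by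
  simp only [spectralVector, Finset.sup'_le_iff, Finset.mem_univ, true_imp_iff,
    le_ciInf_iff (Set.finite_range _).bddBelow]
  rw [forall_comm]
  exact forall₂_congr fun s i => ite_rpow_inv_le_iff (hω s) (u i).2.1 (hp s i)

lemma spectralCopula_update_one {ι : Type*} [Fintype ι] {d : ℕ} [NeZero d]
    {p : ι → Fin d → ℝ} (hp : ∀ s i, 0 ≤ p s i) (hsum : ∀ i, ∑ s, p s i = 1) (i : Fin d)
    (a : unitInterval) : spectralCopula p (Function.update 1 i a) = a := by
  have key : ∀ s, (⨅ j, ((Function.update 1 i a : Fin d → unitInterval) j : ℝ) ^ p s j)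
      = (a : ℝ) ^ p s i := fun s => by
    refine le_antisymm ?_ (le_ciInf fun j => ?_)
    · exact (ciInf_le (Set.finite_range _).bddBelow i).trans (by simp)
    · by_cases h : j = i
      · subst h; simp
      · simpa [Function.update_of_ne h] using Real.rpow_le_one a.2.1 a.2.2 (hp s i)
  rw [spectralCopula, Finset.prod_congr rfl fun s _ => key s,
    ← Real.rpow_sum_of_nonneg a.2.1 fun s _ => hp s i, hsum, Real.rpow_one]

/-- A law supported on `(-∞,1]^d` whose distribution function `C` satisfies `C(1, …, a, …, 1) = a` has
uniform margins. -/
lemma map_eval_eq_uniform {d : ℕ} {μ : Measure (Fin d → ℝ)} [IsProbabilityMeasure μ]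
    {C : (Fin d → unitInterval) → ℝ} (hC : ∀ u, C u = μ.real {x | ∀ i, x i ≤ (u i : ℝ)})
    (hle : ∀ᵐ x ∂μ, ∀ i, x i ≤ 1) (hm : ∀ i a, C (Function.update 1 i a) = a) (i : Fin d) :
    μ.map (fun x => x i) = volume.restrict (Set.Icc (0 : ℝ) 1) := by
  have hmeas : Measurable fun x : Fin d → ℝ => x i := measurable_pi_apply i
  have : IsProbabilityMeasure (μ.map fun x => x i) :=
    Measure.isProbabilityMeasure_map hmeas.aemeasurable
  have key : ∀ a : unitInterval, μ.real {x | x i ≤ (a : ℝ)} = a := fun a => by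
    refine Eq.trans ?_ ((hC _).symm.trans (hm i a))
    refine measureReal_congr ?_
    filter_upwards [hle] with x hx
    refine propext ⟨fun (h : x i ≤ a) j => ?_, fun h => show x i ≤ a by simpa using h i⟩
    by_cases hj : j = i
    · subst hj; simpa using h
    · simpa [Function.update_of_ne hj] using hx j
  refine Measure.ext_of_Iic _ _ fun a => ?_
  rw [← measureReal_eq_measureReal_iff, map_measureReal_apply hmeas measurableSet_Iic,
    measureReal_restrict_apply measurableSet_Iic]
  change μ.real {x | x i ≤ a} = _
  rcases lt_or_ge a 0 with ha | ha
  · have h1 : Set.Iic a ∩ Set.Icc 0 1 = ∅ := by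
      ext x; simp only [Set.mem_inter_iff, Set.mem_Iic, Set.mem_Icc, Set.mem_empty_iff_false,
        iff_false]
      rintro ⟨h, h', -⟩; linarith
    rw [h1, measureReal_empty]
    refine le_antisymm ?_ measureReal_nonneg
    refine (measureReal_mono (s₂ := {x : Fin d → ℝ | x i ≤ ((0 : unitInterval) : ℝ)})
      fun x (hx : x i ≤ a) => ?_).trans_eq (key 0)
    exact hx.trans ha.le
  · rcases le_or_gt a 1 with ha1 | ha1
    · have h1 : Set.Iic a ∩ Set.Icc 0 1 = Set.Icc 0 a := by
        ext x; simp only [Set.mem_inter_iff, Set.mem_Iic, Set.mem_Icc]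
        exact ⟨fun h => ⟨h.2.1, h.1⟩, fun h => ⟨h.2, h.1, h.2.trans ha1⟩⟩
      rw [h1, Real.volume_real_Icc_of_le ha, sub_zero]
      exact key ⟨a, ha, ha1⟩
    · have h1 : Set.Iic a ∩ Set.Icc 0 1 = Set.Icc 0 1 := by
        ext x; simp only [Set.mem_inter_iff, Set.mem_Iic, Set.mem_Icc]
        exact ⟨fun h => h.2, fun h => ⟨h.2.trans ha1.le, h⟩⟩
      rw [h1, Real.volume_real_Icc_of_le zero_le_one, sub_zero]
      refine le_antisymm measureReal_le_one ?_
      refine (key 1).symm.trans_le (measureReal_mono fun x (hx : x i ≤ 1) => ?_)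
      exact hx.trans ha1.le

theorem isCopula_spectralCopula {ι : Type*} [Fintype ι] [Nonempty ι] {d : ℕ} [NeZero d]
    {p : ι → Fin d → ℝ} (hp : ∀ s i, 0 ≤ p s i) (hsum : ∀ i, ∑ s, p s i = 1) :
    IsCopula (spectralCopula p) := by
  have hmeas := measurable_spectralVector p
  have hprob : IsProbabilityMeasure ((uniformCube ι).map (spectralVector p)) :=
    Measure.isProbabilityMeasure_map hmeas.aemeasurable
  have hms : ∀ u : Fin d → unitInterval,
      MeasurableSet {x : Fin d → ℝ | ∀ i, x i ≤ (u i : ℝ)} := fun u => by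
    simp only [Set.ofPred_forall]
    exact MeasurableSet.iInter fun i => measurableSet_le (measurable_pi_apply i) measurable_const
  have hdf : ∀ u, spectralCopula p u = ((uniformCube ι).map (spectralVector p)).real
      {x | ∀ i, x i ≤ (u i : ℝ)} := fun u => by
    rw [map_measureReal_apply hmeas (hms u), spectralCopula,
      ← uniformCube_real_Iic (fun s => (iInf_rpow_mem (hp s) u).1)
        (fun s => (iInf_rpow_mem (hp s) u).2)]
    refine measureReal_congr ?_
    filter_upwards [uniformCube_ae_mem ι] with ω hω
    exact propext (spectralVector_le_iff hp hω u).symm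
  have hle : ∀ᵐ x ∂(uniformCube ι).map (spectralVector p), ∀ i, x i ≤ 1 := by
    refine (ae_map_iff hmeas.aemeasurable (hms 1)).2 ?_
    filter_upwards [uniformCube_ae_mem ι] with ω hω
    refine (spectralVector_le_iff hp hω 1).2 fun s => ?_
    simpa using (hω s).2
  exact ⟨_, hprob, map_eval_eq_uniform hdf hle (spectralCopula_update_one hp hsum), hdf⟩

theorem isExtremeValueCopula_spectralCopula {ι : Type*} [Fintype ι] [Nonempty ι] {d : ℕ}
    [NeZero d] {p : ι → Fin d → ℝ} (hp : ∀ s i, 0 ≤ p s i) (hsum : ∀ i, ∑ s, p s i = 1) :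
    IsExtremeValueCopula (spectralCopula p) := by
  refine ⟨isCopula_spectralCopula hp hsum, fun u t => ?_⟩
  rw [spectralCopula, spectralCopula, ← Real.finsetProd_rpow]
  · refine Finset.prod_congr rfl fun s _ => ?_
    have h : ∀ i, ((unitPow (u i) t : unitInterval) : ℝ) ^ p s i
        = ((u i : ℝ) ^ p s i) ^ (t : ℝ) := fun i => by
      rw [unitPow, ← Real.rpow_mul (u i).2.1, ← Real.rpow_mul (u i).2.1, mul_comm]
    simp_rw [h]
    obtain ⟨j, hj⟩ := exists_eq_ciInf_of_finite (f := fun i => (u i : ℝ) ^ p s i)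
    refine le_antisymm ?_ (le_ciInf fun i => ?_)
    · rw [← hj]
      exact ciInf_le (Set.finite_range _).bddBelow j
    · exact Real.rpow_le_rpow (iInf_rpow_mem (hp s) u).1
        (ciInf_le (Set.finite_range _).bddBelow i) t.2
  · exact fun s _ => (iInf_rpow_mem (hp s) u).1

lemma iInf_exp_neg {d : ℕ} [NeZero d] (f : Fin d → ℝ) :
    ⨅ i, Real.exp (-f i) = Real.exp (-⨆ i, f i) := by
  obtain ⟨j, hj⟩ := exists_eq_ciSup_of_finite (f := f)
  refine le_antisymm ?_ (le_ciInf fun i => ?_)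
  · rw [← hj]
    exact ciInf_le (Set.finite_range fun i => Real.exp (-f i)).bddBelow j
  · exact Real.exp_le_exp.2 (neg_le_neg (le_ciSup (Set.finite_range _).bddAbove i))

lemma stdfOf_spectralCopula {ι : Type*} [Fintype ι] {d : ℕ} [NeZero d] (p : ι → Fin d → ℝ)
    (x : Fin d → ℝ≥0) : stdfOf (spectralCopula p) x = ∑ s, ⨆ i, (x i : ℝ) * p s i := by
  have h : ∀ s, ⨅ i, ((expNeg (x i) : unitInterval) : ℝ) ^ p s i
      = Real.exp (-⨆ i, (x i : ℝ) * p s i) := fun s => by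
    rw [← iInf_exp_neg]
    refine iInf_congr fun i => ?_
    rw [expNeg, ← Real.exp_mul, neg_mul]
  rw [stdfOf, spectralCopula, Finset.prod_congr rfl fun s _ => h s, ← Real.exp_sum, Real.log_exp,
    Finset.sum_neg_distrib, neg_neg]

/-! ### The extremal functions are stable tail dependence functions -/

lemma sum_perm_apply {n : ℕ} [NeZero n] (f : Fin n → ℝ) (i : Fin n) :
    ∑ σ : Equiv.Perm (Fin n), f (σ i) = ((n - 1).factorial : ℝ) * ∑ j, f j := by
  have h : ∀ j, ∑ σ : Equiv.Perm (Fin n), f (σ j) = ∑ σ : Equiv.Perm (Fin n), f (σ i) :=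
    fun j => Fintype.sum_equiv (Equiv.mulRight (Equiv.swap i j)) _ _ fun σ => by simp
  have h2 : (n : ℝ) * ∑ σ : Equiv.Perm (Fin n), f (σ i)
      = n * (((n - 1).factorial : ℝ) * ∑ j, f j) := by
    calc (n : ℝ) * ∑ σ : Equiv.Perm (Fin n), f (σ i)
        = ∑ j, ∑ σ : Equiv.Perm (Fin n), f (σ j) := by simp [h]
      _ = ∑ _σ : Equiv.Perm (Fin n), ∑ j, f j := by
          rw [Finset.sum_comm]
          exact Finset.sum_congr rfl fun σ _ => Equiv.sum_comp σ f
      _ = _ := by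
          rw [Finset.sum_const, Finset.card_univ, Fintype.card_perm, Fintype.card_fin,
            ← Nat.mul_factorial_pred (NeZero.ne n), nsmul_eq_mul, Nat.cast_mul, mul_assoc]
  exact mul_left_cancel₀ (Nat.cast_ne_zero.2 (NeZero.ne n)) h2

/-- The extreme-value copula with stable tail dependence function `extremalSTDF q`: the spectral
copula whose weights are the permutations of `q`, normalized by `(n-1)!`. -/
noncomputable def extremalCopula {n : ℕ} (q : Fin n → ℝ) : (Fin n → unitInterval) → ℝ :=
  spectralCopula fun (σ : Equiv.Perm (Fin n)) i => q (σ i) / ((n - 1).factorial : ℝ)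

theorem isExtremeValueCopula_extremalCopula {n : ℕ} [NeZero n] {q : Fin n → ℝ}
    (hq : q ∈ stdSimplex ℝ (Fin n)) : IsExtremeValueCopula (extremalCopula q) := by
  refine isExtremeValueCopula_spectralCopula
    (fun σ i => div_nonneg (hq.1 _) (Nat.cast_nonneg _)) fun i => ?_
  rw [← Finset.sum_div, sum_perm_apply, hq.2, mul_one,
    div_self (Nat.cast_ne_zero.2 (Nat.factorial_ne_zero _))]

lemma isSymmetricFun_extremalCopula {n : ℕ} (q : Fin n → ℝ) :
    IsSymmetricFun (extremalCopula q) := by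
  intro τ u
  refine Fintype.prod_equiv (Equiv.mulRight τ⁻¹) _ _ fun σ => ?_
  exact Equiv.iInf_congr τ fun i => by simp

lemma stdfOf_extremalCopula {n : ℕ} [NeZero n] (q : Fin n → ℝ) :
    stdfOf (extremalCopula q) = extremalSTDF q := by
  ext x
  rw [extremalCopula, stdfOf_spectralCopula, extremalSTDF, Finset.mul_sum]
  refine Finset.sum_congr rfl fun σ _ => ?_
  rw [Real.mul_iSup_of_nonneg (by positivity)]
  exact iSup_congr fun i => by ring

lemma isSymmetricFun_stdfOf {d : ℕ} {C : (Fin d → unitInterval) → ℝ} (h : IsSymmetricFun C) :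
    IsSymmetricFun (stdfOf C) :=
  fun σ x => congrArg (fun c => -Real.log c) (h σ fun i => expNeg (x i))

theorem extremalSTDF_mem_symSTDF {n : ℕ} [NeZero n] {q : Fin n → ℝ}
    (hq : q ∈ stdSimplex ℝ (Fin n)) : extremalSTDF q ∈ symSTDF n :=
  ⟨⟨_, isExtremeValueCopula_extremalCopula hq, (stdfOf_extremalCopula q).symm⟩,
    stdfOf_extremalCopula q ▸ isSymmetricFun_stdfOf (isSymmetricFun_extremalCopula q)⟩

/-! ### Laws with a given stable tail dependence function -/

/-- The random vector `Z` has distribution function `exp (-ℓ(-log u₁, …, -log u_n))` on `(0,1]^n`, where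
`ℓ` is homogeneous. The factor `t` records homogeneity: `P(Z ≤ e^{-tx}) = e^{-tℓ(x)}`. -/
def HasSTDF {Ω : Type*} [MeasurableSpace Ω] {n : ℕ} (P : Measure Ω) (Z : Fin n → Ω → ℝ)
    (ℓ : (Fin n → ℝ≥0) → ℝ) : Prop :=
  ∀ (t : ℝ≥0) (x : Fin n → ℝ≥0),
    P.real {ω | ∀ i, Z i ω ≤ Real.exp (-((t : ℝ) * x i))} = Real.exp (-((t : ℝ) * ℓ x))

lemma IsCopulaLaw.real_Iic {d : ℕ} {μ : Measure (Fin d → ℝ)} {C : (Fin d → unitInterval) → ℝ}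
    (h : IsCopulaLaw μ C) (i : Fin d) (a : unitInterval) : μ.real {x | x i ≤ (a : ℝ)} = a := by
  have hm : Measurable fun x : Fin d → ℝ => x i := measurable_pi_apply i
  change μ.real ((fun x : Fin d → ℝ => x i) ⁻¹' Set.Iic (a : ℝ)) = a
  rw [← map_measureReal_apply hm measurableSet_Iic, h.uniform,
    measureReal_restrict_apply measurableSet_Iic]
  have h1 : Set.Iic (a : ℝ) ∩ Set.Icc 0 1 = Set.Icc 0 (a : ℝ) := by
    ext x; simp only [Set.mem_inter_iff, Set.mem_Iic, Set.mem_Icc]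
    exact ⟨fun h => ⟨h.2.1, h.1⟩, fun h => ⟨h.2, h.1, h.2.trans a.2.2⟩⟩
  rw [h1, Real.volume_real_Icc_of_le a.2.1, sub_zero]

lemma IsCopulaLaw.ae_le_one {d : ℕ} {μ : Measure (Fin d → ℝ)} {C : (Fin d → unitInterval) → ℝ}
    (h : IsCopulaLaw μ C) : ∀ᵐ x ∂μ, ∀ i, x i ≤ 1 := by
  have := h.isProb
  refine ae_all_iff.2 fun i => ?_
  have hms : MeasurableSet {x : Fin d → ℝ | x i ≤ ((1 : unitInterval) : ℝ)} :=
    measurableSet_le (measurable_pi_apply i) measurable_const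
  have h1 : μ {x | x i ≤ ((1 : unitInterval) : ℝ)} = 1 := by
    rw [← ENNReal.toReal_eq_one_iff, ← measureReal_def, h.real_Iic i 1]; rfl
  exact (prob_compl_eq_zero_iff hms).2 h1

lemma IsCopulaLaw.one_sub_sum_le {d : ℕ} {μ : Measure (Fin d → ℝ)}
    {C : (Fin d → unitInterval) → ℝ} (h : IsCopulaLaw μ C) (u : Fin d → unitInterval) :
    1 - ∑ i, (1 - (u i : ℝ)) ≤ C u := by
  have := h.isProb
  have hms : ∀ i, MeasurableSet {x : Fin d → ℝ | x i ≤ (u i : ℝ)} := fun i =>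
    measurableSet_le (measurable_pi_apply i) measurable_const
  have h1 : {x : Fin d → ℝ | ∀ i, x i ≤ (u i : ℝ)}ᶜ = ⋃ i, {x | x i ≤ (u i : ℝ)}ᶜ := by
    ext x; simp
  have h2 : μ.real {x : Fin d → ℝ | ∀ i, x i ≤ (u i : ℝ)}ᶜ ≤ ∑ i, (1 - (u i : ℝ)) := by
    rw [h1]
    refine (measureReal_iUnion_fintype_le _).trans_eq (Finset.sum_congr rfl fun i _ => ?_)
    rw [probReal_compl_eq_one_sub (hms i), h.real_Iic]
  have hms' : MeasurableSet {x : Fin d → ℝ | ∀ i, x i ≤ (u i : ℝ)} := by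
    simp only [Set.ofPred_forall]
    exact MeasurableSet.iInter hms
  rw [probReal_compl_eq_one_sub hms', ← h.df] at h2
  linarith

lemma unitPow_expNeg (x t : ℝ≥0) : unitPow (expNeg x) t = expNeg (t * x) := by
  refine Subtype.ext ?_
  change Real.exp (-(x : ℝ)) ^ (t : ℝ) = Real.exp (-((t * x : ℝ≥0) : ℝ))
  rw [← Real.exp_mul, NNReal.coe_mul]
  congr 1; ring

/-- Positivity shows that the logarithm in `stdfOf` is never evaluated at `0`: if `C` vanished at
`u = e^{-x}`, it would vanish at `u ^ t` for all `t > 0`, but `C(u ^ t) → 1` as `t → 0`. -/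
lemma IsExtremeValueCopula.pos {d : ℕ} {C : (Fin d → unitInterval) → ℝ}
    (hC : IsExtremeValueCopula C) (x : Fin d → ℝ≥0) : 0 < C fun i => expNeg (x i) := by
  obtain ⟨⟨μ, hμ⟩, hpow⟩ := hC
  have h0 : 0 ≤ C fun i => expNeg (x i) := by rw [hμ.df]; exact measureReal_nonneg
  refine lt_of_le_of_ne h0 fun hz => ?_
  have hcont : Filter.Tendsto (fun t : ℝ≥0 => 1 - ∑ i, (1 - Real.exp (-((t * x i : ℝ≥0) : ℝ))))
      (𝓝[>] 0) (𝓝 1) := by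
    have : Continuous fun t : ℝ≥0 => 1 - ∑ i, (1 - Real.exp (-((t * x i : ℝ≥0) : ℝ))) := by
      fun_prop
    simpa using (this.tendsto 0).mono_left nhdsWithin_le_nhds
  obtain ⟨t, ht, htpos⟩ :=
    ((hcont.eventually (lt_mem_nhds one_pos)).and self_mem_nhdsWithin).exists
  have h1 := hμ.one_sub_sum_le fun i => expNeg (t * x i)
  have h2 := hpow (fun i => expNeg (x i)) t
  simp_rw [unitPow_expNeg] at h2
  rw [h2, ← hz, Real.zero_rpow (NNReal.coe_ne_zero.2 (ne_of_gt htpos))] at h1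
  exact absurd (ht.trans_le h1) (lt_irrefl _)

lemma IsExtremeValueCopula.apply_expNeg {d : ℕ} {C : (Fin d → unitInterval) → ℝ}
    (hC : IsExtremeValueCopula C) (t : ℝ≥0) (x : Fin d → ℝ≥0) :
    C (fun i => expNeg (t * x i)) = Real.exp (-((t : ℝ) * stdfOf C x)) := by
  have h2 := hC.2 (fun i => expNeg (x i)) t
  simp_rw [unitPow_expNeg] at h2
  rw [h2, Real.rpow_def_of_pos (hC.pos x), stdfOf]
  congr 1; ring

/-- Any selection `e` of distinct coordinates has the tail dependence function obtained by setting
the other arguments to `0`. -/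
theorem IsExtremeValueCopula.hasSTDF {d n : ℕ} {C : (Fin d → unitInterval) → ℝ}
    (hC : IsExtremeValueCopula C) {μ : Measure (Fin d → ℝ)} (hμ : IsCopulaLaw μ C)
    {e : Fin n → Fin d} (he : Function.Injective e) :
    HasSTDF μ (fun i z => z (e i)) fun x => stdfOf C (Function.extend e x 0) := by
  intro t x
  rw [← hC.apply_expNeg, hμ.df]
  refine measureReal_congr ?_
  filter_upwards [hμ.ae_le_one] with z hz
  refine propext ⟨fun (h : ∀ i, z (e i) ≤ Real.exp (-((t : ℝ) * x i))) j => ?_,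
    fun h => show ∀ i, z (e i) ≤ Real.exp (-((t : ℝ) * x i)) from fun i => ?_⟩
  · by_cases hj : ∃ i, e i = j
    · obtain ⟨i, rfl⟩ := hj
      simpa [he.extend_apply, expNeg] using h i
    · simpa [Function.extend_apply' _ _ _ hj, expNeg] using hz j
  · simpa [he.extend_apply, expNeg] using h (e i)

/-- By symmetry, it is irrelevant which `n` of the `d` coordinates the margin retains. -/
lemma IsSymmetricFun.extend_eq_stdfMargin {n d : ℕ} {ℓ : (Fin d → ℝ≥0) → ℝ}
    (hℓ : IsSymmetricFun ℓ) (hnd : n ≤ d) {e : Fin n → Fin d} (he : Function.Injective e)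
    (x : Fin n → ℝ≥0) : ℓ (Function.extend e x 0) = stdfMargin n ℓ x := by
  obtain ⟨π, hπ⟩ := Equiv.Perm.exists_extending_pair (Fin.castLE hnd) e
    (Fin.castLE_injective hnd) he
  rw [← hℓ π, stdfMargin]
  congr 1
  funext j
  by_cases hj : (j : ℕ) < n
  · rw [dif_pos hj]
    exact (congrArg _ (hπ ⟨j, hj⟩)).trans (he.extend_apply _ _ _)
  · rw [dif_neg hj, Function.extend_apply']
    · rfl
    · rintro ⟨i, hi⟩
      rw [← hπ, π.injective.eq_iff] at hi
      exact hj (by rw [← hi]; exact i.2)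

/-! ### Probabilities of small boxes -/

section Boxes

variable {Ω : Type*} [MeasurableSpace Ω] {n : ℕ} {P : Measure Ω} {Z : Fin n → Ω → ℝ}

lemma measurableSet_lowerBox (hZ : ∀ i, Measurable (Z i)) (f : Fin n → ℝ) :
    MeasurableSet {ω | ∀ i, Z i ω ≤ f i} := by
  simp only [Set.ofPred_forall]
  exact MeasurableSet.iInter fun i => measurableSet_le (hZ i) measurable_const

lemma measurableSet_box (hZ : ∀ i, Measurable (Z i)) (S : Finset (Fin n)) (f g : Fin n → ℝ) :
    MeasurableSet {ω | (∀ i, Z i ω ≤ f i) ∧ ∀ i ∈ S, g i < Z i ω} := by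
  have h : MeasurableSet {ω | ∀ i ∈ S, g i < Z i ω} := by
    simp only [Set.ofPred_forall]
    exact MeasurableSet.iInter fun i => MeasurableSet.iInter fun _ =>
      measurableSet_lt measurable_const (hZ i)
  exact (measurableSet_lowerBox hZ f).inter h

/-- Inclusion–exclusion: the probability of a box is an alternating sum of values of the distribution
function. Only the coordinates in `S` have a lower bound. -/
theorem measureReal_box [IsFiniteMeasure P] (hZ : ∀ i, Measurable (Z i)) (S : Finset (Fin n))
    {f g : Fin n → ℝ} (hgf : ∀ i, g i ≤ f i) :
    P.real {ω | (∀ i, Z i ω ≤ f i) ∧ ∀ i ∈ S, g i < Z i ω} =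
      ∑ T ∈ S.powerset, (-1) ^ T.card *
        P.real {ω | ∀ i, Z i ω ≤ if i ∈ T then g i else f i} := by
  induction S using Finset.induction_on generalizing f with
  | empty => simp
  | insert j S hj ih =>
    have hf' : ∀ i, g i ≤ Function.update f j (g j) i := fun i => by
      by_cases h : i = j
      · subst h; simp
      · simpa [Function.update_of_ne h] using hgf i
    have hsub : {ω | (∀ i, Z i ω ≤ Function.update f j (g j) i) ∧ ∀ i ∈ S, g i < Z i ω} ⊆
        {ω | (∀ i, Z i ω ≤ f i) ∧ ∀ i ∈ S, g i < Z i ω} := fun ω hω => by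
      refine ⟨fun i => (hω.1 i).trans ?_, hω.2⟩
      by_cases h : i = j
      · subst h; simpa using hgf i
      · simp [Function.update_of_ne h]
    have hdiff : {ω | (∀ i, Z i ω ≤ f i) ∧ ∀ i ∈ insert j S, g i < Z i ω} =
        {ω | (∀ i, Z i ω ≤ f i) ∧ ∀ i ∈ S, g i < Z i ω} \
        {ω | (∀ i, Z i ω ≤ Function.update f j (g j) i) ∧ ∀ i ∈ S, g i < Z i ω} := by
      ext ω
      simp only [Set.mem_ofPred_eq, Finset.forall_mem_insert, Set.mem_sdiff]
      refine ⟨fun h => ⟨⟨h.1, h.2.2⟩, fun h' => ?_⟩, fun h => ⟨h.1.1, ?_, h.1.2⟩⟩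
      · have := h'.1 j
        rw [Function.update_self] at this
        exact absurd h.2.1 (not_lt.2 this)
      · by_contra hle
        refine h.2 ⟨fun i => ?_, h.1.2⟩
        by_cases hij : i = j
        · subst hij; simpa using hle
        · simpa [Function.update_of_ne hij] using h.1.1 i
    rw [hdiff, measureReal_sdiff hsub (measurableSet_box hZ _ _ _), ih hgf, ih hf',
      Finset.sum_powerset_insert hj, sub_eq_add_neg, ← Finset.sum_neg_distrib]
    congr 1
    refine Finset.sum_congr rfl fun T hT => ?_
    have hjT : j ∉ T := fun h => hj (Finset.mem_powerset.1 hT h)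
    rw [Finset.card_insert_of_notMem hjT, pow_succ, mul_neg_one, neg_mul]
    congr 4
    ext ω
    refine forall_congr' fun i => ?_
    by_cases hij : i = j
    · subst hij; simp [hjT]
    · simp [hij]

/-- The subsets `T` and `insert j T` contribute opposite terms. -/
lemma sum_powerset_neg_one_pow_mul_eq_zero {S : Finset (Fin n)} {j : Fin n} (hj : j ∈ S)
    {h : Finset (Fin n) → ℝ} (hh : ∀ T, j ∉ T → h (insert j T) = h T) :
    ∑ T ∈ S.powerset, (-1) ^ T.card * h T = 0 := by
  rw [← Finset.insert_erase hj, Finset.sum_powerset_insert (Finset.notMem_erase j S),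
    ← Finset.sum_add_distrib]
  refine Finset.sum_eq_zero fun T hT => ?_
  have hjT : j ∉ T := fun h => Finset.notMem_erase j S (Finset.mem_powerset.1 hT h)
  rw [Finset.card_insert_of_notMem hjT, hh T hjT]
  ring

/-- If `y i₀ * q i₀` is dominated by the smaller one of the two possible terms at `i₁`, then the
maximum does not depend on the choice made at `i₀`. -/
lemma iSup_ite_insert_eq {x y q : Fin n → ℝ} (hq : ∀ i, 0 ≤ q i) (hxy : ∀ i, x i ≤ y i)
    {i₀ i₁ : Fin n} (hne : i₀ ≠ i₁) (h : y i₀ * q i₀ ≤ x i₁ * q i₁) (T : Finset (Fin n)) :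
    ⨆ i, (if i ∈ insert i₀ T then y i else x i) * q i =
      ⨆ i, (if i ∈ T then y i else x i) * q i := by
  have : Nonempty (Fin n) := ⟨i₀⟩
  have hle : ∀ i, (if i ∈ T then y i else x i) * q i ≤ ⨆ i, (if i ∈ T then y i else x i) * q i :=
    fun i => le_ciSup (f := fun i => (if i ∈ T then y i else x i) * q i)
      (Set.finite_range _).bddAbove i
  refine le_antisymm (ciSup_le fun i => ?_)
    (ciSup_mono (Set.finite_range _).bddAbove fun i => ?_)
  · by_cases hi : i = i₀
    · subst hi
      rw [if_pos (Finset.mem_insert_self _ _)]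
      refine h.trans (le_trans ?_ (hle i₁))
      refine mul_le_mul_of_nonneg_right ?_ (hq i₁)
      split_ifs
      exacts [hxy _, le_rfl]
    · simpa [hi] using hle i
  · refine mul_le_mul_of_nonneg_right ?_ (hq i)
    by_cases hi : i = i₀
    · subst hi
      rw [if_pos (Finset.mem_insert_self _ _)]
      split_ifs
      exacts [le_rfl, hxy _]
    · simp [hi]

lemma HasSTDF.measureReal_box [IsFiniteMeasure P] {ℓ : (Fin n → ℝ≥0) → ℝ}
    (hℓ : HasSTDF P Z ℓ) (hZ : ∀ i, Measurable (Z i)) (S : Finset (Fin n))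
    {x y : Fin n → ℝ≥0} (hxy : ∀ i, x i ≤ y i) (t : ℝ≥0) :
    P.real {ω | (∀ i, Z i ω ≤ Real.exp (-((t : ℝ) * x i))) ∧
        ∀ i ∈ S, Real.exp (-((t : ℝ) * y i)) < Z i ω} =
      ∑ T ∈ S.powerset, (-1) ^ T.card *
        Real.exp (-((t : ℝ) * ℓ fun i => if i ∈ T then y i else x i)) := by
  rw [_root_.measureReal_box hZ S (f := fun i => Real.exp (-((t : ℝ) * x i)))
    (g := fun i => Real.exp (-((t : ℝ) * y i)))]
  · refine Finset.sum_congr rfl fun T _ => ?_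
    rw [← hℓ]
    congr 3
    ext ω
    refine forall_congr' fun i => ?_
    split_ifs <;> rfl
  · exact fun i => Real.exp_le_exp.2 (neg_le_neg (mul_le_mul_of_nonneg_left
      (NNReal.coe_le_coe.2 (hxy i)) t.2))

/-- The hypothesis says that no ray spanned by `(1 / q (σ i))_i` meets the box: if it enters below
`y i₀` in coordinate `i₀`, it is still below `x i₁` in coordinate `i₁`. -/
lemma sum_neg_one_pow_mul_extremalSTDF {q : Fin n → ℝ} (hq : ∀ i, 0 ≤ q i) {S : Finset (Fin n)}
    {x y : Fin n → ℝ≥0} (hxy : ∀ i, x i ≤ y i)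
    (h : ∀ σ : Equiv.Perm (Fin n), ∃ i₀ ∈ S, ∃ i₁, i₀ ≠ i₁ ∧
      (y i₀ : ℝ) * q (σ i₀) ≤ x i₁ * q (σ i₁)) :
    ∑ T ∈ S.powerset, (-1) ^ T.card * extremalSTDF q (fun i => if i ∈ T then y i else x i) = 0 := by
  simp only [extremalSTDF, mul_left_comm _ (1 / ((n - 1).factorial : ℝ))]
  rw [← Finset.mul_sum]
  simp only [Finset.mul_sum]
  rw [Finset.sum_comm]
  refine Finset.sum_eq_zero fun σ _ => ?_
  rw [← Finset.mul_sum]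
  refine mul_eq_zero_of_right _ ?_
  obtain ⟨i₀, hi₀, i₁, hne, hle⟩ := h σ
  refine sum_powerset_neg_one_pow_mul_eq_zero hi₀ fun T _ => ?_
  have := iSup_ite_insert_eq (x := fun i => (x i : ℝ)) (y := fun i => (y i : ℝ))
    (q := fun i => q (σ i)) (fun i => hq _) (fun i => NNReal.coe_le_coe.2 (hxy i)) hne hle T
  simpa only [apply_ite NNReal.toReal] using this

/-- Boxes that avoid the rays spanned by the vectors `(1 / q (σ i))_i` have probability `o(t)` when
scaled by `t`. -/
theorem HasSTDF.tendsto_box [IsFiniteMeasure P] {q : Fin n → ℝ} (hq : ∀ i, 0 ≤ q i)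
    (hℓ : HasSTDF P Z (extremalSTDF q)) (hZ : ∀ i, Measurable (Z i)) {S : Finset (Fin n)}
    (hS : S.Nonempty) {x y : Fin n → ℝ≥0} (hxy : ∀ i, x i ≤ y i)
    (h : ∀ σ : Equiv.Perm (Fin n), ∃ i₀ ∈ S, ∃ i₁, i₀ ≠ i₁ ∧
      (y i₀ : ℝ) * q (σ i₀) ≤ x i₁ * q (σ i₁)) :
    Filter.Tendsto (fun t : ℝ => t⁻¹ * P.real {ω | (∀ i, Z i ω ≤ Real.exp (-(t * x i))) ∧
        ∀ i ∈ S, Real.exp (-(t * y i)) < Z i ω}) (𝓝[>] 0) (𝓝 0) := by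
  set L : Finset (Fin n) → ℝ := fun T => extremalSTDF q (fun i => if i ∈ T then y i else x i)
    with hL
  have hderiv : HasDerivAt (fun t : ℝ => ∑ T ∈ S.powerset, (-1) ^ T.card * Real.exp (-(t * L T)))
      0 0 := by
    have : HasDerivAt (fun t : ℝ => ∑ T ∈ S.powerset, (-1) ^ T.card * Real.exp (-(t * L T)))
        (∑ T ∈ S.powerset, (-1) ^ T.card * (Real.exp (-(0 * L T)) * -(1 * L T))) 0 :=
      HasDerivAt.fun_sum fun T _ =>
        (((hasDerivAt_id (0 : ℝ)).mul_const (L T)).neg.exp).const_mul _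
    convert this using 1
    simp only [zero_mul, neg_zero, Real.exp_zero, one_mul, mul_neg, Finset.sum_neg_distrib]
    rw [sum_neg_one_pow_mul_extremalSTDF hq hxy h, neg_zero]
  have h0 : ∑ T ∈ S.powerset, (-1 : ℝ) ^ T.card * Real.exp (-(0 * L T)) = 0 := by
    have := Finset.sum_powerset_neg_one_pow_card_of_nonempty hS
    simp only [zero_mul, neg_zero, Real.exp_zero, mul_one]
    exact_mod_cast this
  refine hderiv.tendsto_slope_zero_right.congr' ?_
  filter_upwards [self_mem_nhdsWithin] with t ht
  rw [zero_add, h0, sub_zero, smul_eq_mul]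
  congr 1
  exact (hℓ.measureReal_box hZ S hxy ⟨t, (Set.mem_Ioi.1 ht).le⟩).symm

end Boxes

/-! ### Extremal functions are not margins -/

lemma exists_forall_mul_le_of_strictMono {n : ℕ} {q : Fin n → ℝ} (hq : StrictMono q) :
    ∃ θ : ℝ≥0, 1 < θ ∧ ∀ i j, i < j → (θ : ℝ) * q i ≤ q j := by
  have h : ∀ᶠ θ : ℝ≥0 in 𝓝[>] 1, ∀ i j, i < j → (θ : ℝ) * q i ≤ q j := by
    refine Filter.eventually_all.2 fun i => Filter.eventually_all.2 fun j => ?_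
    by_cases hij : i < j
    · have hc : Continuous fun θ : ℝ≥0 => (θ : ℝ) * q i := by fun_prop
      have h1 : Filter.Tendsto (fun θ : ℝ≥0 => (θ : ℝ) * q i) (𝓝[>] 1) (𝓝 (q i)) := by
        simpa using (hc.tendsto 1).mono_left nhdsWithin_le_nhds
      exact (h1.eventually (gt_mem_nhds (hq hij))).mono fun θ hθ _ => hθ.le
    · exact Filter.Eventually.of_forall fun θ h => absurd h hij
  obtain ⟨θ, h1, h2⟩ := ((eventually_mem_nhdsWithin (s := Set.Ioi (1 : ℝ≥0))).and h).exists
  exact ⟨θ, h1, h2⟩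

lemma exists_succAbove_pair {n : ℕ} (hn : 2 ≤ n) {a b : Fin (n + 1)} (hab : a ≠ b) :
    ∃ (k : Fin (n + 1)) (i j : Fin n), i ≠ j ∧ k.succAbove i = a ∧ k.succAbove j = b := by
  obtain ⟨k, hka, hkb⟩ := Fin.exists_ne_and_ne_of_two_lt a b (by omega)
  obtain ⟨i, rfl⟩ := Fin.exists_succAbove_eq hka.symm
  obtain ⟨j, rfl⟩ := Fin.exists_succAbove_eq hkb.symm
  exact ⟨k, i, j, fun h => hab (h ▸ rfl), rfl, rfl⟩

/-- Read `w = e^{-tY}`, `b = e^{-tθ}`, `r = e^{-tR}`, `c = e^{-tRθ}`: if the minimum of the `n + 1`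
coordinates of `Y` is less than `θ`, then after deleting one of them either all others are less than
`R`, or one is less than `θ` and another one at least `Rθ`, or two lie between `R` and `Rθ`. -/
lemma exists_degenerate_subvector {n : ℕ} (hn : 2 ≤ n) {w : Fin (n + 1) → ℝ} {b r c : ℝ}
    (hcb : c ≤ b) {a : Fin (n + 1)} (ha : b < w a) :
    ∃ k : Fin (n + 1), (∀ i, r < w (k.succAbove i)) ∨ ∃ i j : Fin n, i ≠ j ∧
      ((b < w (k.succAbove i) ∧ w (k.succAbove j) ≤ c) ∨
        ((w (k.succAbove i) ≤ r ∧ w (k.succAbove j) ≤ r) ∧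
          c < w (k.succAbove i) ∧ c < w (k.succAbove j))) := by
  by_contra hcon
  push Not at hcon
  have hfar : ∀ m, c < w m := fun m => by
    by_contra! hm
    have ham : a ≠ m := fun h => by subst h; linarith
    obtain ⟨k, i, j, hij, hi, hj⟩ := exists_succAbove_pair hn ham
    have := ((hcon k).2 i j hij).1 (hi ▸ ha)
    rw [hj] at this
    exact absurd hm (not_le.2 this)
  obtain ⟨i₁, h₁⟩ := (hcon 0).1
  obtain ⟨i₂, h₂⟩ := (hcon ((0 : Fin (n + 1)).succAbove i₁)).1
  obtain ⟨k, i, j, hij, hi, hj⟩ := exists_succAbove_pair hn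
    (Fin.succAbove_ne ((0 : Fin (n + 1)).succAbove i₁) i₂)
  have := ((hcon k).2 i j hij).2 ⟨by rwa [hi], by rwa [hj]⟩ (hfar _)
  exact absurd (hfar _) (not_lt.2 this)

theorem stdfMargin_ne_extremalSTDF {n : ℕ} (hn : 2 ≤ n) {q : Fin n → ℝ} (hmono : StrictMono q)
    (hpos : ∀ i, 0 < q i) {d : ℕ} (hd : n + 1 ≤ d) {ℓ : (Fin d → ℝ≥0) → ℝ}
    (hℓ : ℓ ∈ symSTDF d) : stdfMargin n ℓ ≠ extremalSTDF q := by
  intro hmargin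
  obtain ⟨⟨C, hC, rfl⟩, hsymm⟩ := hℓ
  obtain ⟨μ, hμ⟩ := hC.1
  have hprob := hμ.isProb
  obtain ⟨θ, hθ, hθq⟩ := exists_forall_mul_le_of_strictMono hmono
  have hq0 : ∀ i, 0 ≤ q i := fun i => (hpos i).le
  set lo : Fin n := ⟨0, by omega⟩ with hlo
  set hi : Fin n := ⟨n - 1, by omega⟩ with hhi
  have hlole : ∀ i, q lo ≤ q i := fun i => hmono.monotone (Fin.mk_le_of_le_val (Nat.zero_le _))
  have hlehi : ∀ i, q i ≤ q hi := fun i => hmono.monotone (Fin.le_def.2 (by simp [hhi]; omega))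
  obtain ⟨R, hR1, hR⟩ : ∃ R : ℝ≥0, 1 ≤ R ∧ (R : ℝ) * q lo = q hi := by
    refine ⟨⟨q hi / q lo, div_nonneg (hq0 _) (hq0 _)⟩, ?_, div_mul_cancel₀ _ (hpos lo).ne'⟩
    exact NNReal.coe_le_coe.1 ((one_le_div (hpos lo)).2 (hlole hi))
  have hRq : ∀ i j, q i ≤ R * q j := fun i j =>
    ((hlehi i).trans_eq hR.symm).trans (mul_le_mul_of_nonneg_left (hlole j) R.2)
  set ι : Fin (n + 1) → Fin d := Fin.castLE hd with hι
  have hιinj : Function.Injective ι := Fin.castLE_injective hd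
  set e : Fin (n + 1) → Fin n → Fin d := fun k i => ι (k.succAbove i) with he
  have heinj : ∀ k, Function.Injective (e k) := fun k =>
    hιinj.comp Fin.succAbove_right_injective
  have hstdf : ∀ k, HasSTDF μ (fun i z => z (e k i)) (extremalSTDF q) := fun k t x => by
    rw [← hmargin, ← hsymm.extend_eq_stdfMargin (by omega) (heinj k)]
    exact hC.hasSTDF hμ (heinj k) t x
  have hmeas : ∀ k i, Measurable fun z : Fin d → ℝ => z (e k i) := fun k i =>
    measurable_pi_apply _
  have hθ0 : (1 : ℝ≥0) ≤ R * θ := one_le_mul hR1 hθ.le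
  -- For the coordinates selected by `e k`, with `Y = -log z`: all in `[t, tR)`; one below `tθ` and
  -- another one at least `tRθ`; two in `[tR, tRθ)`. In the last two, all coordinates are at least `t`.
  let N₁ : Fin (n + 1) → ℝ → Set (Fin d → ℝ) := fun k t =>
    {z | (∀ i, z (e k i) ≤ Real.exp (-(t * ((1 : ℝ≥0) : ℝ)))) ∧
      ∀ i ∈ (Finset.univ : Finset (Fin n)), Real.exp (-(t * R)) < z (e k i)}
  let N₂ : Fin (n + 1) → {p : Fin n × Fin n // p.1 ≠ p.2} → ℝ → Set (Fin d → ℝ) := fun k p t =>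
    {z | (∀ i, z (e k i) ≤ Real.exp (-(t * ((if i = p.1.2 then R * θ else 1 : ℝ≥0) : ℝ)))) ∧
      ∀ i ∈ ({p.1.1} : Finset (Fin n)),
        Real.exp (-(t * ((if i = p.1.2 then R * θ else θ : ℝ≥0) : ℝ))) < z (e k i)}
  let N₃ : Fin (n + 1) → {p : Fin n × Fin n // p.1 ≠ p.2} → ℝ → Set (Fin d → ℝ) := fun k p t =>
    {z | (∀ i, z (e k i) ≤
        Real.exp (-(t * ((if i = p.1.1 ∨ i = p.1.2 then R else 1 : ℝ≥0) : ℝ)))) ∧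
      ∀ i ∈ ({p.1.1, p.1.2} : Finset (Fin n)),
        Real.exp (-(t * ((R * θ : ℝ≥0) : ℝ))) < z (e k i)}
  have hN₁ : ∀ k, Filter.Tendsto (fun t => t⁻¹ * μ.real (N₁ k t)) (𝓝[>] 0) (𝓝 0) := fun k => by
    refine (hstdf k).tendsto_box hq0 (hmeas k) (x := fun _ => 1) (y := fun _ => R)
      ⟨lo, Finset.mem_univ _⟩ (fun _ => hR1) fun σ =>
        ⟨σ⁻¹ lo, Finset.mem_univ _, σ⁻¹ hi, fun h => ?_, ?_⟩
    -- The ray of `σ` has its minimum at `σ⁻¹ hi` and its maximum, `R` times as large, at `σ⁻¹ lo`.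
    · have := congrArg Fin.val ((σ⁻¹).injective h)
      simp only [hlo, hhi] at this
      omega
    · simp [hR]
  have hN₂ : ∀ k p, Filter.Tendsto (fun t => t⁻¹ * μ.real (N₂ k p t)) (𝓝[>] 0) (𝓝 0) :=
    fun k p => by
    refine (hstdf k).tendsto_box hq0 (hmeas k) (x := fun i => if i = p.1.2 then R * θ else 1)
      (y := fun i => if i = p.1.2 then R * θ else θ) ⟨p.1.1, Finset.mem_singleton_self _⟩
      (fun i => ?_) fun σ => ⟨p.1.1, Finset.mem_singleton_self _, p.1.2, p.2, ?_⟩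
    · split_ifs
      exacts [le_rfl, hθ.le]
    · rw [if_neg p.2, if_pos rfl, NNReal.coe_mul, mul_comm (R : ℝ), mul_assoc]
      exact mul_le_mul_of_nonneg_left (hRq _ _) θ.2
  have hN₃ : ∀ k p, Filter.Tendsto (fun t => t⁻¹ * μ.real (N₃ k p t)) (𝓝[>] 0) (𝓝 0) :=
    fun k p => by
    refine (hstdf k).tendsto_box hq0 (hmeas k)
      (x := fun i => if i = p.1.1 ∨ i = p.1.2 then R else 1) (y := fun _ => R * θ)
      ⟨p.1.1, Finset.mem_insert_self _ _⟩ (fun i => ?_) fun σ => ?_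
    · split_ifs
      exacts [le_mul_of_one_le_right' hθ.le, hθ0]
    · have hlt : ∀ i j : Fin n, (i < j) → ((R * θ : ℝ≥0) : ℝ) * q i ≤ R * q j := fun i j hij => by
        rw [NNReal.coe_mul, mul_assoc]
        exact mul_le_mul_of_nonneg_left (hθq i j hij) R.2
      rcases lt_or_gt_of_ne (σ.injective.ne p.2) with h | h
      · exact ⟨p.1.1, by simp, p.1.2, p.2, by simpa using hlt _ _ h⟩
      · exact ⟨p.1.2, by simp, p.1.1, p.2.symm, by simpa using hlt _ _ h⟩
  -- `A` is the value of the tail dependence function of the first `n + 1` coordinates at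
  -- `(1, …, 1)`; the minimum of their `Y` lies in `[t, tθ)` with probability `e^{-tA} - e^{-tθA}`.
  set A : ℝ := stdfOf C (Function.extend ι (fun _ => 1) 0) with hA
  have hAdf : ∀ t : ℝ≥0, μ.real {z | ∀ m, z (ι m) ≤ Real.exp (-(t : ℝ))} =
      Real.exp (-((t : ℝ) * A)) := fun t => by
    have := hC.hasSTDF hμ hιinj t fun _ => 1
    simpa using this
  have hA1 : 1 ≤ A := by
    have h1 := hμ.real_Iic (ι 0) (expNeg 1)
    have h2 := hAdf 1
    have h3 : μ.real {z | ∀ m, z (ι m) ≤ Real.exp (-((1 : ℝ≥0) : ℝ))} ≤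
        μ.real {z | z (ι 0) ≤ (expNeg 1 : ℝ)} :=
      measureReal_mono fun z (hz : ∀ m, z (ι m) ≤ Real.exp (-((1 : ℝ≥0) : ℝ))) => hz 0
    rw [h1, h2] at h3
    simpa [expNeg] using h3
  have hbound : ∀ t : ℝ, 0 < t → Real.exp (-(t * A)) - Real.exp (-(t * θ * A)) ≤
      ∑ k, (μ.real (N₁ k t) + ∑ p, (μ.real (N₂ k p t) + μ.real (N₃ k p t))) := fun t ht => by
    have h1 : μ.real {z | ∀ m, z (ι m) ≤ Real.exp (-t)} = Real.exp (-(t * A)) :=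
      hAdf ⟨t, ht.le⟩
    have h2 : μ.real {z | ∀ m, z (ι m) ≤ Real.exp (-(t * θ))} = Real.exp (-(t * θ * A)) :=
      hAdf (NNReal.mk t ht.le * θ)
    rw [← h1, ← h2]
    have hcover : {z : Fin d → ℝ | ∀ m, z (ι m) ≤ Real.exp (-t)} \
        {z | ∀ m, z (ι m) ≤ Real.exp (-(t * θ))} ⊆
        ⋃ k, (N₁ k t ∪ ⋃ p, (N₂ k p t ∪ N₃ k p t)) := by
      rintro z ⟨hz1, hz2⟩
      replace hz1 : ∀ m, z (ι m) ≤ Real.exp (-t) := hz1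
      replace hz2 : ¬ ∀ m, z (ι m) ≤ Real.exp (-(t * θ)) := hz2
      push Not at hz2
      obtain ⟨a, ha⟩ := hz2
      have hcb : Real.exp (-(t * ((R * θ : ℝ≥0) : ℝ))) ≤ Real.exp (-(t * θ)) :=
        Real.exp_le_exp.2 (neg_le_neg (mul_le_mul_of_nonneg_left
          (NNReal.coe_le_coe.2 (le_mul_of_one_le_left' hR1)) ht.le))
      obtain ⟨k, hk⟩ := exists_degenerate_subvector hn (w := fun m => z (ι m))
        (r := Real.exp (-(t * R))) hcb ha
      refine Set.mem_iUnion.2 ⟨k, ?_⟩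
      rcases hk with hk | ⟨i, j, hij, hk | hk⟩
      · exact Or.inl ⟨fun i => by simpa using hz1 _, fun i _ => hk i⟩
      · refine Or.inr (Set.mem_iUnion.2 ⟨⟨(i, j), hij⟩, Or.inl ⟨fun m => ?_, fun m hm => ?_⟩⟩)
        · by_cases hm : m = j
          · subst hm; simpa using hk.2
          · simpa [hm] using hz1 _
        · rw [Finset.mem_singleton] at hm
          subst hm
          simpa [hij] using hk.1
      · refine Or.inr (Set.mem_iUnion.2 ⟨⟨(i, j), hij⟩, Or.inr ⟨fun m => ?_, fun m hm => ?_⟩⟩)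
        · by_cases hm : m = i ∨ m = j
          · simp only [hm, if_true]
            rcases hm with rfl | rfl
            exacts [hk.1.1, hk.1.2]
          · simpa [hm] using hz1 _
        · simp only [Finset.mem_insert, Finset.mem_singleton] at hm
          rcases hm with rfl | rfl
          exacts [hk.2.1, hk.2.2]
    refine (le_measureReal_sdiff (h := by finiteness)).trans ((measureReal_mono hcover).trans ?_)
    refine (measureReal_iUnion_fintype_le _).trans (Finset.sum_le_sum fun k _ => ?_)
    refine (measureReal_union_le _ _).trans (add_le_add le_rfl ?_)
    exact (measureReal_iUnion_fintype_le _).trans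
      (Finset.sum_le_sum fun p _ => measureReal_union_le _ _)
  have hright : Filter.Tendsto (fun t : ℝ => t⁻¹ *
      ∑ k, (μ.real (N₁ k t) + ∑ p, (μ.real (N₂ k p t) + μ.real (N₃ k p t)))) (𝓝[>] 0) (𝓝 0) := by
    have := tendsto_finsetSum Finset.univ fun k _ => (hN₁ k).add
      (tendsto_finsetSum Finset.univ fun p _ => (hN₂ k p).add (hN₃ k p))
    simpa only [Finset.mul_sum, mul_add, add_zero, Finset.sum_const_zero] using this
  have hleft : Filter.Tendsto
      (fun t : ℝ => t⁻¹ * (Real.exp (-(t * A)) - Real.exp (-(t * θ * A)))) (𝓝[>] 0)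
      (𝓝 (((θ : ℝ) - 1) * A)) := by
    have h1 : HasDerivAt (fun t : ℝ => Real.exp (-(t * A)) - Real.exp (-(t * θ * A)))
        (Real.exp (-(0 * A)) * -(1 * A) - Real.exp (-(0 * θ * A)) * -(1 * θ * A)) 0 :=
      ((hasDerivAt_id (0 : ℝ)).mul_const A).neg.exp.sub
        (((hasDerivAt_id (0 : ℝ)).mul_const (θ : ℝ)).mul_const A).neg.exp
    have h2 := h1.tendsto_slope_zero_right
    simp only [zero_add, zero_mul, neg_zero, Real.exp_zero, sub_self, sub_zero, smul_eq_mul,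
      one_mul] at h2
    convert h2 using 2
    ring
  have hle : ((θ : ℝ) - 1) * A ≤ 0 := by
    refine le_of_tendsto_of_tendsto hleft hright ?_
    filter_upwards [self_mem_nhdsWithin] with t ht
    exact mul_le_mul_of_nonneg_left (hbound t ht) (inv_nonneg.2 (Set.mem_Ioi.1 ht).le)
  have hθ' : (1 : ℝ) < θ := by exact_mod_cast hθ
  nlinarith

lemma exists_strictMono_mem_stdSimplex {n : ℕ} (hn : 2 ≤ n) :
    ∃ q : Fin n → ℝ, q ∈ stdSimplex ℝ (Fin n) ∧ StrictMono q ∧ ∀ i, 0 < q i := by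
  have hpos : 0 < ∑ j : Fin n, ((j : ℝ) + 1) :=
    Finset.sum_pos (fun i _ => by positivity) ⟨⟨0, by omega⟩, Finset.mem_univ _⟩
  refine ⟨fun i => ((i : ℝ) + 1) / ∑ j : Fin n, ((j : ℝ) + 1), ⟨fun i => by positivity, ?_⟩,
    fun i j hij => ?_, fun i => by positivity⟩
  · rw [← Finset.sum_div, div_self hpos.ne']
  · refine div_lt_div_of_pos_right ?_ hpos
    simpa using hij

theorem symSTDFMargins_ssubset {n : ℕ} (hn : 2 ≤ n) {k : ℕ} (hk : 1 ≤ k) :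
    symSTDFMargins n (n + k) ⊂ symSTDF n := by
  have : NeZero n := ⟨by omega⟩
  obtain ⟨q, hq, hmono, hpos⟩ := exists_strictMono_mem_stdSimplex hn
  refine ⟨fun ℓ h => h.1, fun h => ?_⟩
  obtain ⟨-, ℓ, hℓ, heq⟩ := h (extremalSTDF_mem_symSTDF hq)
  exact stdfMargin_ne_extremalSTDF hn hmono hpos (by omega) hℓ heq

/-! ### A copula that is not conditionally iid -/

/-- The left side is the square of the mean, the right side the mean of the square, of the conditional
probability of `X i ∈ B`. -/
theorem IsCondIIDLaw.sq_le {d : ℕ} {μ : Measure (Fin d → ℝ)} (h : IsCondIIDLaw.{u} μ)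
    {i j : Fin d} (hij : i ≠ j) {B : Set ℝ} (hB : MeasurableSet B) :
    μ.real {z | z i ∈ B} ^ 2 ≤ μ.real {z | z i ∈ B ∧ z j ∈ B} := by
  obtain ⟨Ω, m, mΩ, P, hP, X, hX, rfl, hm, hind, hid⟩ := h
  have hXm : Measurable fun ω k => X k ω := measurable_pi_lambda _ hX
  have hmi : ∀ k, MeasurableSet (X k ⁻¹' B) := fun k => hX k hB
  have hint : ∀ s : Set Ω, MeasurableSet s → ∫ ω, (P⟦s | m⟧) ω ∂P = P.real s := fun s hs => by
    rw [integral_condExp hm, integral_indicator hs, setIntegral_const, smul_eq_mul, mul_one]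
  have h1 : (P.map fun ω k => X k ω).real {z | z i ∈ B} = P.real (X i ⁻¹' B) :=
    map_measureReal_apply hXm (measurable_pi_apply i hB)
  have h2 : (P.map fun ω k => X k ω).real {z | z i ∈ B ∧ z j ∈ B} =
      P.real (X i ⁻¹' B ∩ X j ⁻¹' B) :=
    map_measureReal_apply hXm ((measurable_pi_apply i hB).inter (measurable_pi_apply j hB))
  have hprod : P⟦X i ⁻¹' B ∩ X j ⁻¹' B | m⟧ =ᵐ[P]
      fun ω => (P⟦X i ⁻¹' B | m⟧) ω * (P⟦X j ⁻¹' B | m⟧) ω := by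
    have h := hind (fun k => if k = i ∨ k = j then B else Set.univ) fun k => by
      split_ifs
      exacts [hB, MeasurableSet.univ]
    have hset : (⋂ k, X k ⁻¹' (if k = i ∨ k = j then B else Set.univ)) =
        X i ⁻¹' B ∩ X j ⁻¹' B := by
      ext ω
      simp only [Set.mem_iInter, Set.mem_preimage, Set.mem_inter_iff]
      refine ⟨fun h => ⟨by simpa using h i, by simpa using h j⟩, fun h k => ?_⟩
      split_ifs with hk
      · rcases hk with rfl | rfl
        exacts [h.1, h.2]
      · trivial
    rw [hset] at h
    refine h.trans (Filter.Eventually.of_forall fun ω => ?_)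
    dsimp only
    rw [Finset.prod_eq_mul i j hij]
    · simp
    · intro k _ hk
      rw [if_neg (not_or.2 hk), Set.preimage_univ, Set.indicator_univ, condExp_const hm]
    · simp
    · simp
  rw [h1, h2]
  set c := P.real (X i ⁻¹' B) with hc
  have hle : (fun ω => 2 * c * (P⟦X i ⁻¹' B | m⟧) ω - c ^ 2) ≤ᵐ[P]
      P⟦X i ⁻¹' B ∩ X j ⁻¹' B | m⟧ := by
    filter_upwards [hprod, hid j i B hB] with ω hω1 hω2
    rw [hω1, hω2]
    nlinarith [sq_nonneg ((P⟦X i ⁻¹' B | m⟧) ω - c)]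
  have := integral_mono_ae ((integrable_condExp.const_mul _).sub (integrable_const _))
    integrable_condExp hle
  rw [hint _ ((hmi i).inter (hmi j)), integral_sub' (integrable_condExp.const_mul _)
    (integrable_const _), integral_const_mul, hint _ (hmi i), ← hc] at this
  simp only [integral_const, probReal_univ, one_smul] at this
  linarith

lemma extremalSTDF_extend_pair {n : ℕ} {q : Fin n → ℝ} (hq : ∀ i, 0 ≤ q i) {e : Fin 2 → Fin n}
    (he : Function.Injective e) (x : Fin 2 → ℝ≥0) :
    extremalSTDF q (Function.extend e x 0) = 1 / ((n - 1).factorial : ℝ) *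
      ∑ σ : Equiv.Perm (Fin n), max (x 0 * q (σ (e 0))) (x 1 * q (σ (e 1))) := by
  have : Nonempty (Fin n) := ⟨e 0⟩
  rw [extremalSTDF]
  congr 1
  refine Finset.sum_congr rfl fun σ _ => ?_
  have hle := le_ciSup (f := fun i => ((Function.extend e x 0 i : ℝ≥0) : ℝ) * q (σ i))
    (Set.finite_range _).bddAbove
  refine le_antisymm (ciSup_le fun i => ?_) (max_le ?_ ?_)
  · by_cases hi : ∃ k, e k = i
    · obtain ⟨k, rfl⟩ := hi
      rw [he.extend_apply]
      fin_cases k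
      exacts [le_max_left _ _, le_max_right _ _]
    · rw [Function.extend_apply' _ _ _ hi]
      simpa using Or.inl (mul_nonneg (x 0).2 (hq (σ (e 0))))
  · simpa [he.extend_apply] using hle (e 0)
  · simpa [he.extend_apply] using hle (e 1)

/-- If any two of the weights differ at least by a factor of `2` (or vanish), then
`ℓ(1,2) = 3/2 ℓ(1,1)` for the pair margins, and an interval violates `IsCondIIDLaw.sq_le`. -/
theorem not_isCondIIDCopula_extremalCopula {n : ℕ} [NeZero n] {q : Fin n → ℝ}
    (hq : q ∈ stdSimplex ℝ (Fin n)) (hsep : ∀ i j, i ≠ j → 2 * q i ≤ q j ∨ 2 * q j ≤ q i)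
    {i₀ i₁ : Fin n} (hne : i₀ ≠ i₁) (h₀ : 0 < q i₀) (h₁ : 0 < q i₁) :
    ¬ IsCondIIDCopula.{u} (extremalCopula q) := by
  rintro ⟨μ, hμ, hiid⟩
  have hprob := hμ.isProb
  set e : Fin 2 → Fin n := ![i₀, i₁] with he_def
  have he : Function.Injective e := by
    intro a b hab
    fin_cases a <;> fin_cases b <;> simp_all [hne.symm]
  have hstdf : HasSTDF μ (fun i z => z (e i)) fun x => extremalSTDF q (Function.extend e x 0) := by
    have := (isExtremeValueCopula_extremalCopula hq).hasSTDF hμ he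
    rwa [stdfOf_extremalCopula] at this
  have hform := extremalSTDF_extend_pair hq.1 he
  set ℓ : (Fin 2 → ℝ≥0) → ℝ := fun x => extremalSTDF q (Function.extend e x 0) with hℓ
  set c : ℝ := 1 / ((n - 1).factorial : ℝ) with hc
  have hcpos : 0 < c := by positivity
  set a : ℝ := ℓ ![1, 1] with ha_def
  have ha : a = c * ∑ σ : Equiv.Perm (Fin n), max (q (σ i₀)) (q (σ i₁)) := by
    have := hform ![1, 1]
    simpa [he_def] using this
  have h12 : ℓ ![1, 2] = c * ∑ σ : Equiv.Perm (Fin n), max (q (σ i₀)) (2 * q (σ i₁)) := by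
    have := hform ![1, 2]
    simpa [he_def] using this
  have h21 : ℓ ![2, 1] = c * ∑ σ : Equiv.Perm (Fin n), max (2 * q (σ i₀)) (q (σ i₁)) := by
    have := hform ![2, 1]
    simpa [he_def] using this
  have h22 : ℓ ![2, 2] = 2 * a := by
    have := hform ![2, 2]
    rw [ha, mul_left_comm, Finset.mul_sum _ _ 2]
    simpa [he_def, mul_max_of_nonneg] using this
  have hswap : ℓ ![2, 1] = ℓ ![1, 2] := by
    rw [h12, h21]
    congr 1
    refine Fintype.sum_equiv (Equiv.mulRight (Equiv.swap i₀ i₁)) _ _ fun σ => ?_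
    simp [max_comm]
  have hsum : ℓ ![1, 2] + ℓ ![2, 1] = 3 * a := by
    rw [h12, h21, ha, ← mul_add, ← Finset.sum_add_distrib, mul_left_comm, Finset.mul_sum _ _ 3]
    refine congrArg (c * ·) (Finset.sum_congr rfl fun σ _ => ?_)
    have hp := hq.1 (σ i₀)
    have hr := hq.1 (σ i₁)
    rcases hsep _ _ (σ.injective.ne hne) with h | h
    · rw [max_eq_right (by linarith), max_eq_right h, max_eq_right (by linarith)]; ring
    · rw [max_eq_left h, max_eq_left (by linarith), max_eq_left (by linarith)]; ring
  have ha0 : 0 ≤ a := by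
    rw [ha]
    exact mul_nonneg hcpos.le (Finset.sum_nonneg fun σ _ => le_max_of_le_left (hq.1 _))
  have ha2 : a < 2 := by
    have hlt : ∑ σ : Equiv.Perm (Fin n), max (q (σ i₀)) (q (σ i₁)) <
        ∑ σ : Equiv.Perm (Fin n), (q (σ i₀) + q (σ i₁)) := by
      refine Finset.sum_lt_sum (fun σ _ => max_le ?_ ?_) ⟨1, Finset.mem_univ _, ?_⟩
      · linarith [hq.1 (σ i₁)]
      · linarith [hq.1 (σ i₀)]
      · simpa using ⟨h₁, h₀⟩
    rw [Finset.sum_add_distrib, sum_perm_apply, sum_perm_apply, hq.2] at hlt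
    calc a < c * (((n - 1).factorial : ℝ) * 1 + ((n - 1).factorial : ℝ) * 1) := by
          rw [ha]; exact mul_lt_mul_of_pos_left hlt hcpos
      _ = 2 := by rw [hc]; field_simp; norm_num
  set s : ℝ := Real.exp (-(a / 4)) with hs
  set w : ℝ := Real.exp (-(1 / 2)) with hw
  have hsw : w < s := Real.exp_lt_exp.2 (by linarith)
  have hs1 : s ≤ 1 := Real.exp_le_one_iff.2 (by linarith)
  have hw2 : 1 / 2 < w := by
    have := Real.add_one_lt_exp (x := -(1 / 2)) (by norm_num)
    linarith
  have hw1 : w < 1 := hsw.trans_le hs1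
  have hboth : μ.real {z | z (e 0) ∈ Set.Ioc (w ^ 2) w ∧ z (e 1) ∈ Set.Ioc (w ^ 2) w} =
      (s - s ^ 2) ^ 2 := by
    have hset : {z : Fin n → ℝ | z (e 0) ∈ Set.Ioc (w ^ 2) w ∧ z (e 1) ∈ Set.Ioc (w ^ 2) w} =
        {z | (∀ i, z (e i) ≤ Real.exp (-(((1 / 2 : ℝ≥0) : ℝ) * (1 : ℝ≥0)))) ∧
          ∀ i ∈ Finset.univ, Real.exp (-(((1 / 2 : ℝ≥0) : ℝ) * (2 : ℝ≥0))) < z (e i)} := by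
      have e1 : Real.exp (-(((1 / 2 : ℝ≥0) : ℝ) * (1 : ℝ≥0))) = w := by simp [hw]
      have e2 : Real.exp (-(((1 / 2 : ℝ≥0) : ℝ) * (2 : ℝ≥0))) = w ^ 2 := by
        rw [hw, ← Real.exp_nat_mul]; congr 1; push_cast; ring
      rw [e1, e2]
      ext z
      simp only [Set.mem_ofPred_eq, Set.mem_Ioc, Fin.forall_fin_two, Finset.mem_univ, true_imp_iff]
      tauto
    have hs_pow : ∀ k : ℕ, s ^ k = Real.exp (-(k * a / 4)) := fun k => by
      rw [hs, ← Real.exp_nat_mul]; congr 1; ring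
    have hv : ∀ T : Finset (Fin 2), (fun i => if i ∈ T then (2 : ℝ≥0) else 1) =
        ![if 0 ∈ T then 2 else 1, if 1 ∈ T then 2 else 1] := fun T => by
      ext i; fin_cases i <;> rfl
    have hbox := hstdf.measureReal_box (fun i => measurable_pi_apply _) Finset.univ
      (x := fun _ => 1) (y := fun _ => 2) (fun _ => one_le_two) (1 / 2)
    rw [hset, hbox, show (Finset.univ : Finset (Fin 2)) = insert 0 {1} from rfl,
      Finset.sum_powerset_insert (by decide), ← insert_empty_eq (1 : Fin 2),
      Finset.sum_powerset_insert (by decide), Finset.sum_powerset_insert (by decide)]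
    simp only [hv, Finset.powerset_empty, Finset.sum_singleton]
    change _ * Real.exp (-(_ * ℓ ![1, 1])) + _ * Real.exp (-(_ * ℓ ![1, 2])) +
      (_ * Real.exp (-(_ * ℓ ![2, 1])) + _ * Real.exp (-(_ * ℓ ![2, 2]))) = _
    have h12a : ℓ ![1, 2] = 3 / 2 * a := by linarith
    rw [hswap, h12a, h22, ← ha_def]
    have p2 := hs_pow 2
    have p3 := hs_pow 3
    have p4 := hs_pow 4
    have : (s - s ^ 2) ^ 2 = s ^ 2 - 2 * s ^ 3 + s ^ 4 := by ring
    rw [this, p2, p3, p4]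
    have x1 : -(((1 / 2 : ℝ≥0) : ℝ) * a) = -(((2 : ℕ) : ℝ) * a / 4) := by push_cast; ring
    have x2 : -(((1 / 2 : ℝ≥0) : ℝ) * (3 / 2 * a)) = -(((3 : ℕ) : ℝ) * a / 4) := by
      push_cast; ring
    have x3 : -(((1 / 2 : ℝ≥0) : ℝ) * (2 * a)) = -(((4 : ℕ) : ℝ) * a / 4) := by push_cast; ring
    rw [x1, x2, x3]
    simp
    ring
  have hone : μ.real {z | z (e 0) ∈ Set.Ioc (w ^ 2) w} = w - w ^ 2 := by
    have hset : {z : Fin n → ℝ | z (e 0) ∈ Set.Ioc (w ^ 2) w} =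
        {z | z (e 0) ≤ w} \ {z | z (e 0) ≤ w ^ 2} := by
      ext z
      simp [and_comm]
    have hw0 : 0 ≤ w := by linarith
    have hww : w ^ 2 ≤ w := by nlinarith
    rw [hset, measureReal_sdiff]
    · exact congrArg₂ _ (hμ.real_Iic (e 0) ⟨w, hw0, hw1.le⟩)
        (hμ.real_Iic (e 0) ⟨w ^ 2, by positivity, hww.trans hw1.le⟩)
    · exact fun z (hz : z (e 0) ≤ w ^ 2) => hz.trans hww
    · exact measurableSet_le (measurable_pi_apply _) measurable_const
  have key := hiid.sq_le (he.ne (show (0 : Fin 2) ≠ 1 by decide)) (B := Set.Ioc (w ^ 2) w)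
    measurableSet_Ioc
  rw [hboth, hone] at key
  -- `x ↦ x - x²` decreases beyond `1/2`, and `1/2 < w < s`.
  have h3 : s - s ^ 2 < w - w ^ 2 := by nlinarith
  have h4 : 0 ≤ s - s ^ 2 := by nlinarith
  nlinarith

lemma exists_separated_mem_stdSimplex {n : ℕ} (hn : 2 ≤ n) :
    ∃ q : Fin n → ℝ, q ∈ stdSimplex ℝ (Fin n) ∧
      (∀ i j, i ≠ j → 2 * q i ≤ q j ∨ 2 * q j ≤ q i) ∧
      ∃ i₀ i₁, i₀ ≠ i₁ ∧ 0 < q i₀ ∧ 0 < q i₁ := by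
  obtain ⟨m, rfl⟩ := Nat.exists_eq_add_of_le' hn
  refine ⟨Fin.cons (1 / 3) (Fin.cons (2 / 3) 0), ⟨fun i => ?_, ?_⟩, fun i j hij => ?_, 0, 1, ?_⟩
  · refine Fin.cases ?_ (fun i => Fin.cases ?_ (fun i => ?_) i) i <;> simp <;> norm_num
  · simp [Fin.sum_univ_succ]
    norm_num
  · revert hij
    refine Fin.cases ?_ (fun i => Fin.cases ?_ (fun i => ?_) i) i <;>
    refine Fin.cases ?_ (fun j => Fin.cases ?_ (fun j => ?_) j) j <;> simp <;> norm_num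
  · refine ⟨by simp, by simp, ?_⟩
    change (0 : ℝ) < 2 / 3
    norm_num

theorem lemma3 (n : ℕ) (hn : 2 ≤ n) :
    (∀ q : Fin n → ℝ, q ∈ stdSimplex ℝ (Fin n) → StrictMono q →
      (∀ i, 0 < q i) → (∀ i, q i < 1) →
      extremalSTDF q ∈ symSTDF n ∧
        ∀ d : ℕ, n + 1 ≤ d → ∀ ℓ ∈ symSTDF d, stdfMargin n ℓ ≠ extremalSTDF q) ∧
    (∀ k : ℕ, 1 ≤ k → symSTDFMargins n (n + k) ⊂ symSTDF n) ∧
    (∃ C : (Fin n → unitInterval) → ℝ, IsExtremeValueCopula C ∧ IsSymmetricFun C ∧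
      ¬ IsCondIIDCopula.{u} C) := by
  have : NeZero n := ⟨by omega⟩
  refine ⟨fun q hq hmono hpos _ => ⟨extremalSTDF_mem_symSTDF hq, fun d hd ℓ hℓ =>
    stdfMargin_ne_extremalSTDF hn hmono hpos hd hℓ⟩,
    fun k hk => symSTDFMargins_ssubset hn hk, ?_⟩
  obtain ⟨q, hq, hsep, i₀, i₁, hne, h₀, h₁⟩ := exists_separated_mem_stdSimplex hn
  exact ⟨extremalCopula q, isExtremeValueCopula_extremalCopula hq,
    isSymmetricFun_extremalCopula q, not_isCondIIDCopula_extremalCopula hq hsep hne h₀ h₁⟩
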